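/- Let $(M,g,J)$ be a Kähler manifold, i.e. a smooth Riemannian manifold with a $g$-orthogonal almost complex structure $J$ that is parallel for the Levi-Civita connection $\nabla$ of $g$. For an endomorphism field $h\in\Gamma(\mathrm{End}\,TM)$ put $$d_\nabla h(X,Y)=(\nabla_Xh)Y-(\nabla_Yh)X,\qquad \partial h=\tfrac12\bigl(d_\nabla h+d_\nabla h(J\cdot,J\cdot)\bigr),\qquad \bar\partial h=\tfrac12\bigl(d_\nabla h-d_\nabla h(J\cdot,J\cdot)\bigr),$$ $$[h,h]^{FN}(X,Y)=-h^2[X,Y]+h([hX,Y]+[X,hY])-[hX,hY];$$ for a field $H$ of endomorphisms commuting with $J$ put $d^+_\nabla H=\tfrac12\bigl(d_\nabla H+d_\nabla H(J\cdot,J\cdot)\bigr)$; and for a $TM$-valued $2$-form $\alpha$ put $(h\sharp\alpha)(X,Y)=\alpha(hX,Y)+\alpha(X,hY)$ and $(h\circ\alpha)(X,Y)=h(\alpha(X,Y))$. Let $\Lambda^2(M,TM)$ be the bundle of $TM$-valued $2$-forms and $$\Lambda^{1,1}(M,TM)=\{\alpha:\alpha(J\cdot,J\cdot)=\alpha\},\qquad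 \lambda^2(M,TM)=\{\alpha:\alpha(J\cdot,J\cdot)=-\alpha\},$$ $$\lambda^2_\pm(M,TM)=\{\gamma\in\lambda^2(M,TM):\gamma(X,JY)=\pm J\gamma(X,Y)\}.$$ The Kodaira–Spencer bracket $[h,h]^c$ is the $\lambda^2_-$-component of $[h,h]^{FN}$, that is, $[h,h]^c(X,Y)=\tfrac12\bigl(\gamma(X,Y)+J\gamma(X,JY)\bigr)$ with $\gamma=\tfrac12\bigl([h,h]^{FN}-[h,h]^{FN}(J\cdot,J\cdot)\bigr)$. Let $h$ be a smooth $g$-symmetric endomorphism field with $hJ=-Jh$. Then: (i) $\Lambda^2(M,TM)=\lambda^2_-(M,TM)\oplus\lambda^2_+(M,TM)\oplus\Lambda^{1,1}(M,TM)$, and with respect to this splitting the type decomposition of $[h,h]^{FN}$ is $$[h,h]^{FN}=[h,h]^c+h\circ\bar\partial h+\bigl(d^+_\nabla h^2-h\sharp\bar\partial h\bigr),$$ i.e. the equality holds and $[h,h]^c$, $h\circ\bar\partial h$ and $d^+_\nabla h^2-h\sharp\bar\partial h$ are sections of $\lambda^2_-(M,TM)$, $\lambda^2_+(M,TM)$ and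 $\Lambda^{1,1}(M,TM)$ respectively. (ii) $[h,h]^c=-\tfrac12\bigl(h\sharp\partial h-Jh\sharp\partial(Jh)\bigr)=\tfrac12\bigl([h,h]^{FN}-[Jh,Jh]^{FN}\bigr).$ -/

import Mathlib

open Bundle VectorField FiberBundle
open scoped Manifold ContDiff Topology

noncomputable section

namespace KahlerFN

section Fields

variable {E : Type*} [NormedAddCommGroup E] [NormedSpace ℝ E]
  {H : Type*} [TopologicalSpace H] (I : ModelWithCorners ℝ E H)
  (M : Type*) [TopologicalSpace M] [ChartedSpace H M] [IsManifold I ∞ M]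

/-- `Γ(End TM)`: smooth sections of the endomorphism bundle of the tangent bundle. -/
abbrev EndField : Type _ :=
  Cₛ^∞⟮I; E →L[ℝ] E, fun x : M ↦ TangentSpace I x →L[ℝ] TangentSpace I x⟯

variable {I M}

theorem EndField.contMDiff_comp (h k : EndField I M) :
    ContMDiff I (I.prod 𝓘(ℝ, E →L[ℝ] E)) ∞
      (fun x ↦ TotalSpace.mk' (E →L[ℝ] E)
        (E := fun x : M ↦ TangentSpace I x →L[ℝ] TangentSpace I x) x (h x ∘L k x)) := by
  intro x
  have h1 := (contMDiffAt_hom_bundle _).1 (h.contMDiff x)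
  have h2 := (contMDiffAt_hom_bundle _).1 (k.contMDiff x)
  refine (contMDiffAt_hom_bundle _).2 ⟨h1.1, ?_⟩
  refine (h1.2.clm_comp h2.2).congr_of_eventuallyEq ?_
  filter_upwards [(trivializationAt E (TangentSpace I) x).open_baseSet.mem_nhds
    (FiberBundle.mem_baseSet_trivializationAt E (TangentSpace I) x)] with y hy
  ext v
  simp only [ContinuousLinearMap.inCoordinates, ContinuousLinearMap.comp_apply]
  congr 2
  rw [Trivialization.symmL_continuousLinearMapAt _ hy]

/-- The composition `h ∘ k` of two endomorphism fields. -/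
def EndField.comp (h k : EndField I M) : EndField I M where
  toFun x := h x ∘L k x
  contMDiff_toFun := EndField.contMDiff_comp h k

theorem EndField.mdifferentiableAt_apply (h : EndField I M) {x : M}
    {X : Π x : M, TangentSpace I x} (hX : MDiffAt (T% X) x) :
    MDiffAt (T% (fun y ↦ h y (X y))) x :=
  ((h.contMDiff x).mdifferentiableAt (by simp)).clm_bundle_apply hX

end Fields

section LeviCivita

variable {E : Type*} [NormedAddCommGroup E] [NormedSpace ℝ E] [FiniteDimensional ℝ E]
  {H : Type*} [TopologicalSpace H] {I : ModelWithCorners ℝ E H}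
  {M : Type*} [TopologicalSpace M] [ChartedSpace H M] [IsManifold I ∞ M]
  [RiemannianBundle (fun x : M ↦ TangentSpace I x)]
  [IsContMDiffRiemannianBundle I ∞ E (fun x : M ↦ TangentSpace I x)]

/-- The right-hand side of the Koszul formula: the value at `x` of
`½ (X⟨Y,Z⟩ + Y⟨X,Z⟩ - Z⟨X,Y⟩ + ⟨[X,Y],Z⟩ - ⟨[X,Z],Y⟩ - ⟨[Y,Z],X⟩)`. -/
def koszul (Y X Z : Π x : M, TangentSpace I x) (x : M) : ℝ :=
  (1 / 2 : ℝ) * (mvfderiv I (fun y ↦ inner ℝ (Y y) (Z y)) x (X x)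
    + mvfderiv I (fun y ↦ inner ℝ (X y) (Z y)) x (Y x)
    - mvfderiv I (fun y ↦ inner ℝ (X y) (Y y)) x (Z x)
    + inner ℝ (mlieBracket I X Y x) (Z x)
    - inner ℝ (mlieBracket I X Z x) (Y x)
    - inner ℝ (mlieBracket I Y Z x) (X x))

theorem mdifferentiableAt_inner {x : M} {X Y : Π x : M, TangentSpace I x}
    (hX : MDiffAt (T% X) x) (hY : MDiffAt (T% Y) x) :
    MDiffAt (fun y ↦ inner ℝ (X y) (Y y)) x :=
  MDifferentiableAt.inner_bundle (E := fun x : M ↦ TangentSpace I x) hX hY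

theorem koszul_tensorial₁ {x : M} {Y : Π x : M, TangentSpace I x} (hY : MDiffAt (T% Y) x)
    (Z : Π x : M, TangentSpace I x) (hZ : MDiffAt (T% Z) x) :
    TensorialAt I E (fun X ↦ koszul Y X Z x) x where
  smul {f X} hf hX := by
    have : CompleteSpace E := FiniteDimensional.complete ℝ E
    simp [koszul, mvfderiv_fun_mul hf (mdifferentiableAt_inner hX hZ),
      mvfderiv_fun_mul hf (mdifferentiableAt_inner hX hY), mlieBracket_smul_left hf hX,
      inner_add_left, inner_smul_left, inner_smul_right]
    ring
  add {X X'} hX hX' := by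
    have : CompleteSpace E := FiniteDimensional.complete ℝ E
    simp [koszul, mvfderiv_fun_add (mdifferentiableAt_inner hX hZ) (mdifferentiableAt_inner hX' hZ),
      mvfderiv_fun_add (mdifferentiableAt_inner hX hY) (mdifferentiableAt_inner hX' hY), mlieBracket_add_left hX hX',
      inner_add_left, inner_add_right]
    ring

theorem koszul_tensorial₂ {x : M} {Y : Π x : M, TangentSpace I x} (hY : MDiffAt (T% Y) x)
    (X : Π x : M, TangentSpace I x) (hX : MDiffAt (T% X) x) :
    TensorialAt I E (fun Z ↦ koszul Y X Z x) x where
  smul {f Z} hf hZ := by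
    have : CompleteSpace E := FiniteDimensional.complete ℝ E
    simp [koszul, mvfderiv_fun_mul hf (mdifferentiableAt_inner hY hZ),
      mvfderiv_fun_mul hf (mdifferentiableAt_inner hX hZ), mlieBracket_smul_right hf hZ,
      inner_add_left, inner_smul_left, inner_smul_right]
    rw [real_inner_comm (Z x) (Y x), real_inner_comm (Z x) (X x)]
    ring
  add {Z Z'} hZ hZ' := by
    have : CompleteSpace E := FiniteDimensional.complete ℝ E
    simp [koszul, mvfderiv_fun_add (mdifferentiableAt_inner hY hZ) (mdifferentiableAt_inner hY hZ'),
      mvfderiv_fun_add (mdifferentiableAt_inner hX hZ) (mdifferentiableAt_inner hX hZ'), mlieBracket_add_right hZ hZ',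
      inner_add_left, inner_add_right]
    ring

open scoped Classical in
/-- The Levi-Civita derivative of `Y` at `x`, as the linear map `v ↦ ∇_v Y` determined by
`⟨∇_X Y, Z⟩ = koszul Y X Z`. (A field that is not differentiable at `x` gets the value `0`.) -/
def leviCivitaFun (Y : Π x : M, TangentSpace I x) (x : M) :
    TangentSpace I x →L[ℝ] TangentSpace I x :=
  have : FiniteDimensional ℝ (TangentSpace I x) := inferInstanceAs (FiniteDimensional ℝ E)
  have : CompleteSpace (TangentSpace I x) := FiniteDimensional.complete ℝ _
  if hY : MDiffAt (T% Y) x then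
    InnerProductSpace.continuousLinearMapOfBilin (𝕜 := ℝ)
      (TensorialAt.mkHom₂ (fun X Z ↦ koszul Y X Z x) x
        (koszul_tensorial₁ hY) (koszul_tensorial₂ hY))
  else 0

theorem inner_leviCivitaFun {x : M} {X Y Z : Π x : M, TangentSpace I x}
    (hX : MDiffAt (T% X) x) (hY : MDiffAt (T% Y) x) (hZ : MDiffAt (T% Z) x) :
    inner ℝ (leviCivitaFun Y x (X x)) (Z x) = koszul Y X Z x := by
  have : FiniteDimensional ℝ (TangentSpace I x) := inferInstanceAs (FiniteDimensional ℝ E)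
  have : CompleteSpace (TangentSpace I x) := FiniteDimensional.complete ℝ _
  simp only [leviCivitaFun, hY, dite_true]
  rw [InnerProductSpace.continuousLinearMapOfBilin_apply]
  exact TensorialAt.mkHom₂_apply (koszul_tensorial₁ hY) (koszul_tensorial₂ hY) hX hZ

theorem leviCivitaFun_ext {x : M} {A B : TangentSpace I x →L[ℝ] TangentSpace I x}
    (h : ∀ X Z : Π x : M, TangentSpace I x, MDiffAt (T% X) x → MDiffAt (T% Z) x →
      inner ℝ (A (X x)) (Z x) = inner ℝ (B (X x)) (Z x)) : A = B := by
  ext v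
  refine ext_inner_right ℝ fun w ↦ ?_
  simpa using h (extend E v) (extend E w) (mdifferentiableAt_extend ..)
    (mdifferentiableAt_extend ..)

variable (I M) in
/-- The Levi-Civita connection of the Riemannian metric of `M`. -/
def leviCivita : CovariantDerivative I E (TangentSpace I : M → Type _) where
  toFun := leviCivitaFun
  isCovariantDerivativeOnUniv :=
    { add := by
        intro Y Y' x hY hY' _
        have : CompleteSpace E := FiniteDimensional.complete ℝ E
        refine leviCivitaFun_ext fun X Z hX hZ ↦ ?_
        rw [inner_leviCivitaFun hX (mdifferentiableAt_add_section hY hY') hZ,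
          add_apply, inner_add_left, inner_leviCivitaFun hX hY hZ,
          inner_leviCivitaFun hX hY' hZ]
        simp [koszul, mvfderiv_fun_add (mdifferentiableAt_inner hY hZ)
          (mdifferentiableAt_inner hY' hZ), mvfderiv_fun_add (mdifferentiableAt_inner hX hY)
          (mdifferentiableAt_inner hX hY'), mlieBracket_add_left hY hY',
          mlieBracket_add_right hY hY', inner_add_left, inner_add_right]
        ring
      leibniz := by
        intro Y f x hY hf _
        have : CompleteSpace E := FiniteDimensional.complete ℝ E
        refine leviCivitaFun_ext fun X Z hX hZ ↦ ?_
        rw [inner_leviCivitaFun hX (hf.smul_section hY) hZ,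
          add_apply, inner_add_left, smul_apply,
          inner_smul_left, inner_leviCivitaFun hX hY hZ]
        simp [koszul, mvfderiv_fun_mul hf (mdifferentiableAt_inner hY hZ),
          mvfderiv_fun_mul hf (mdifferentiableAt_inner hX hY), mlieBracket_smul_left hf hY,
          mlieBracket_smul_right hf hY, inner_add_left, inner_smul_left, inner_smul_right]
        rw [real_inner_comm (X x) (Y x)]
        ring }

/-- The Levi-Civita connection is torsion-free. -/
theorem leviCivita_torsion [CompleteSpace E] : (leviCivita I M).torsion = 0 := by
  refine (leviCivita I M).torsion_eq_zero_iff.2 fun {X Y x} hX hY ↦ ?_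
  refine ext_inner_right ℝ fun w ↦ ?_
  have hw : MDiffAt (T% (extend E w : Π y : M, TangentSpace I y)) x :=
    mdifferentiableAt_extend ..
  have h1 := inner_leviCivitaFun hX hY hw
  have h2 := inner_leviCivitaFun hY hX hw
  rw [extend_apply_self] at h1 h2
  rw [inner_sub_left]
  change inner ℝ (leviCivitaFun Y x (X x)) w - inner ℝ (leviCivitaFun X x (Y x)) w = _
  rw [h1, h2]
  have h3 : (fun y ↦ inner ℝ (Y y) (X y)) = fun y ↦ inner ℝ (X y) (Y y) :=
    funext fun y ↦ real_inner_comm _ _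
  simp only [koszul, h3, mlieBracket_swap_apply (V := Y) (W := X), inner_neg_left,
    extend_apply_self]
  ring

/-- The Levi-Civita connection is metric: `X⟨Y,Z⟩ = ⟨∇_X Y,Z⟩ + ⟨Y,∇_X Z⟩`. -/
theorem leviCivita_metric {x : M} {X Y Z : Π x : M, TangentSpace I x}
    (hX : MDiffAt (T% X) x) (hY : MDiffAt (T% Y) x) (hZ : MDiffAt (T% Z) x) :
    mvfderiv I (fun y ↦ inner ℝ (Y y) (Z y)) x (X x) =
      inner ℝ (leviCivita I M Y x (X x)) (Z x) + inner ℝ (Y x) (leviCivita I M Z x (X x)) := by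
  have h1 := inner_leviCivitaFun hX hY hZ
  have h2 := inner_leviCivitaFun hX hZ hY
  change _ = inner ℝ (leviCivitaFun Y x (X x)) (Z x) + inner ℝ (Y x) (leviCivitaFun Z x (X x))
  rw [real_inner_comm _ (Y x), h1, h2]
  have h3 : (fun y ↦ inner ℝ (Z y) (Y y)) = fun y ↦ inner ℝ (Y y) (Z y) :=
    funext fun y ↦ real_inner_comm _ _
  simp only [koszul, h3, mlieBracket_swap_apply (V := Z) (W := Y), inner_neg_left]
  ring

end LeviCivita

section Tensors

variable {E : Type*} [NormedAddCommGroup E] [NormedSpace ℝ E] [FiniteDimensional ℝ E]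
  {H : Type*} [TopologicalSpace H] {I : ModelWithCorners ℝ E H}
  {M : Type*} [TopologicalSpace M] [ChartedSpace H M] [IsManifold I ∞ M]

variable (I) in
/-- Bilinear maps `T_xM × T_xM → T_xM`. -/
abbrev Bil (x : M) : Type _ :=
  TangentSpace I x →ₗ[ℝ] TangentSpace I x →ₗ[ℝ] TangentSpace I x

variable (I M) in
/-- Fields of bilinear maps `TM × TM → TM`; the vector-valued two-forms are among them. -/
abbrev BilField : Type _ := Π x : M, Bil I x

theorem nablaEnd_tensorial (cov : CovariantDerivative I E (TangentSpace I : M → Type _))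
    (h : EndField I M) (x : M) :
    TensorialAt I E (fun Y : Π x : M, TangentSpace I x ↦
      cov (fun y ↦ h y (Y y)) x - h x ∘L cov Y x) x where
  smul {f Y} hf hY := by
    have h1 : (fun y ↦ h y ((f • Y) y)) = f • fun y ↦ h y (Y y) := by
      ext y; simp
    rw [h1, cov.isCovariantDerivativeOn.leibniz hY hf,
      cov.isCovariantDerivativeOn.leibniz (h.mdifferentiableAt_apply hY) hf]
    ext v
    simp
    module
  add {Y Y'} hY hY' := by
    have h1 : (fun y ↦ h y ((Y + Y') y)) = (fun y ↦ h y (Y y)) + fun y ↦ h y (Y' y) := by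
      ext y; simp
    rw [h1, cov.isCovariantDerivativeOn.add hY hY',
      cov.isCovariantDerivativeOn.add (h.mdifferentiableAt_apply hY)
        (h.mdifferentiableAt_apply hY')]
    ext v
    simp
    module

/-- The covariant derivative `∇h` of an endomorphism field, `(X, Y) ↦ (∇_X h) Y`, where
`(∇_X h) Y = ∇_X (h Y) - h (∇_X Y)`. -/
def nablaEnd (cov : CovariantDerivative I E (TangentSpace I : M → Type _))
    (h : EndField I M) : BilField I M := fun x ↦
  LinearMap.mk₂ ℝ (fun v w ↦ TensorialAt.mkHom _ x (nablaEnd_tensorial cov h x) w v)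
    (by simp) (by simp) (by simp) (by simp)

/-- The exterior derivative `d_∇ h (X, Y) = (∇_X h) Y - (∇_Y h) X`. -/
def extD (cov : CovariantDerivative I E (TangentSpace I : M → Type _))
    (h : EndField I M) : BilField I M := fun x ↦
  nablaEnd cov h x - (nablaEnd cov h x).flip

/-- `-h²[X,Y] + h([hX,Y] + [X,hY]) - [hX,hY]` at the point `x`. -/
def fnAux (h : EndField I M) (X Y : Π x : M, TangentSpace I x) (x : M) : TangentSpace I x :=
  - h x (h x (mlieBracket I X Y x))
    + h x (mlieBracket I (fun y ↦ h y (X y)) Y x + mlieBracket I X (fun y ↦ h y (Y y)) x)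
    - mlieBracket I (fun y ↦ h y (X y)) (fun y ↦ h y (Y y)) x

theorem fnAux_tensorial₁ (h : EndField I M) (x : M) (Y : Π x : M, TangentSpace I x) :
    TensorialAt I E (fun X ↦ fnAux h X Y x) x where
  smul {f X} hf hX := by
    have : CompleteSpace E := FiniteDimensional.complete ℝ E
    have h1 : (fun y ↦ h y ((f • X) y)) = f • fun y ↦ h y (X y) := by
      ext y; simp
    simp only [fnAux, h1, mlieBracket_smul_left hf hX,
      mlieBracket_smul_left hf (h.mdifferentiableAt_apply hX), map_add, map_smul]
    module
  add {X X'} hX hX' := by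
    have : CompleteSpace E := FiniteDimensional.complete ℝ E
    have h1 : (fun y ↦ h y ((X + X') y)) = (fun y ↦ h y (X y)) + fun y ↦ h y (X' y) := by
      ext y; simp
    simp only [fnAux, h1, mlieBracket_add_left hX hX',
      mlieBracket_add_left (h.mdifferentiableAt_apply hX) (h.mdifferentiableAt_apply hX'), map_add]
    module

theorem fnAux_tensorial₂ (h : EndField I M) (x : M) (X : Π x : M, TangentSpace I x) :
    TensorialAt I E (fun Y ↦ fnAux h X Y x) x where
  smul {f Y} hf hY := by
    have : CompleteSpace E := FiniteDimensional.complete ℝ E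
    have h1 : (fun y ↦ h y ((f • Y) y)) = f • fun y ↦ h y (Y y) := by
      ext y; simp
    simp only [fnAux, h1, mlieBracket_smul_right hf hY,
      mlieBracket_smul_right hf (h.mdifferentiableAt_apply hY), map_add, map_smul]
    module
  add {Y Y'} hY hY' := by
    have : CompleteSpace E := FiniteDimensional.complete ℝ E
    have h1 : (fun y ↦ h y ((Y + Y') y)) = (fun y ↦ h y (Y y)) + fun y ↦ h y (Y' y) := by
      ext y; simp
    simp only [fnAux, h1, mlieBracket_add_right hY hY',
      mlieBracket_add_right (h.mdifferentiableAt_apply hY) (h.mdifferentiableAt_apply hY'), map_add]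
    module

/-- The Frölicher–Nijenhuis bracket `[h,h]`, i.e. the tensor field determined by
`[h,h](X,Y) = -h²[X,Y] + h([hX,Y] + [X,hY]) - [hX,hY]` for vector fields `X`, `Y`. -/
def fnBracket (h : EndField I M) : BilField I M := fun x ↦
  LinearMap.mk₂ ℝ
    (fun v w ↦ TensorialAt.mkHom₂ (fun X Y ↦ fnAux h X Y x) x
      (fun Y _ ↦ fnAux_tensorial₁ h x Y) (fun X _ ↦ fnAux_tensorial₂ h x X) v w)
    (by simp) (by simp) (by simp) (by simp)

/-- `(h ♯ α)(X, Y) = α(hX, Y) + α(X, hY)`. -/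
def sharp (h : EndField I M) (α : BilField I M) : BilField I M := fun x ↦
  (α x).comp (h x : TangentSpace I x →ₗ[ℝ] TangentSpace I x)
    + (α x).compl₂ (h x : TangentSpace I x →ₗ[ℝ] TangentSpace I x)

/-- `(h ∘ α)(X, Y) = h (α(X, Y))`. -/
def postComp (h : EndField I M) (α : BilField I M) : BilField I M := fun x ↦
  (α x).compr₂ (h x : TangentSpace I x →ₗ[ℝ] TangentSpace I x)

/-- `α(J·, J·)`. -/
def pullJ (J : EndField I M) (α : BilField I M) : BilField I M := fun x ↦
  (α x).compl₁₂ (J x : TangentSpace I x →ₗ[ℝ] TangentSpace I x)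
    (J x : TangentSpace I x →ₗ[ℝ] TangentSpace I x)

/-- `½ (α + α(J·, J·))`, the component of `α` in `Λ^{1,1}(M,TM)`. -/
def plusPart (J : EndField I M) (α : BilField I M) : BilField I M :=
  (1 / 2 : ℝ) • (α + pullJ J α)

/-- `½ (α - α(J·, J·))`, the component of `α` in `λ²(M,TM)`. -/
def minusPart (J : EndField I M) (α : BilField I M) : BilField I M :=
  (1 / 2 : ℝ) • (α - pullJ J α)

/-- `½ (γ(X, Y) + J γ(X, JY))`, the component in `λ²₋(M,TM)` of `γ` in `λ²(M,TM)`. -/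
def lambdaMinusPart (J : EndField I M) (γ : BilField I M) : BilField I M := fun x ↦
  (1 / 2 : ℝ) • (γ x + ((γ x).compl₂ (J x : TangentSpace I x →ₗ[ℝ] TangentSpace I x)).compr₂
    (J x : TangentSpace I x →ₗ[ℝ] TangentSpace I x))

/-- The Kodaira–Spencer bracket `[h,h]^c`: the component of `[h,h]^FN` in `λ²₋(M,TM)`. -/
def ksBracket (J h : EndField I M) : BilField I M :=
  lambdaMinusPart J (minusPart J (fnBracket h))

variable (I) in
/-- `Λ²(M,TM)` at `x`: alternating bilinear maps. -/
def Lambda2 (x : M) : Submodule ℝ (Bil I x) where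
  carrier := {α | ∀ v, α v v = 0}
  add_mem' ha hb v := by simp [ha v, hb v]
  zero_mem' v := rfl
  smul_mem' c a ha v := by simp [ha v]

/-- `Λ^{1,1}(M,TM)` at `x`: those `α` in `Λ²` with `α(J·, J·) = α`. -/
def Lambda11 (J : EndField I M) (x : M) : Submodule ℝ (Bil I x) where
  carrier := {α | α ∈ Lambda2 I x ∧ ∀ v w, α (J x v) (J x w) = α v w}
  add_mem' ha hb := ⟨add_mem ha.1 hb.1, fun v w ↦ by simp [ha.2 v w, hb.2 v w]⟩
  zero_mem' := ⟨zero_mem _, fun _ _ ↦ rfl⟩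
  smul_mem' c _ ha := ⟨Submodule.smul_mem _ c ha.1, fun v w ↦ by simp [ha.2 v w]⟩

/-- `λ²(M,TM)` at `x`: those `α` in `Λ²` with `α(J·, J·) = -α`. -/
def lambda2 (J : EndField I M) (x : M) : Submodule ℝ (Bil I x) where
  carrier := {α | α ∈ Lambda2 I x ∧ ∀ v w, α (J x v) (J x w) = - α v w}
  add_mem' ha hb := ⟨add_mem ha.1 hb.1, fun v w ↦ by simp [ha.2 v w, hb.2 v w]; abel⟩
  zero_mem' := ⟨zero_mem _, fun _ _ ↦ by simp⟩
  smul_mem' c _ ha := ⟨Submodule.smul_mem _ c ha.1, fun v w ↦ by simp [ha.2 v w]⟩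

/-- `λ²₋(M,TM)` at `x`: those `γ` in `λ²` with `γ(X, JY) = -J γ(X, Y)`. -/
def lambda2Minus (J : EndField I M) (x : M) : Submodule ℝ (Bil I x) where
  carrier := {γ | γ ∈ lambda2 J x ∧ ∀ v w, γ v (J x w) = - J x (γ v w)}
  add_mem' ha hb := ⟨add_mem ha.1 hb.1, fun v w ↦ by simp [ha.2 v w, hb.2 v w]; abel⟩
  zero_mem' := ⟨zero_mem _, fun _ _ ↦ by simp⟩
  smul_mem' c _ ha := ⟨Submodule.smul_mem _ c ha.1, fun v w ↦ by simp [ha.2 v w]⟩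

/-- `λ²₊(M,TM)` at `x`: those `γ` in `λ²` with `γ(X, JY) = J γ(X, Y)`. -/
def lambda2Plus (J : EndField I M) (x : M) : Submodule ℝ (Bil I x) where
  carrier := {γ | γ ∈ lambda2 J x ∧ ∀ v w, γ v (J x w) = J x (γ v w)}
  add_mem' ha hb := ⟨add_mem ha.1 hb.1, fun v w ↦ by simp [ha.2 v w, hb.2 v w]⟩
  zero_mem' := ⟨zero_mem _, fun _ _ ↦ by simp⟩
  smul_mem' c _ ha := ⟨Submodule.smul_mem _ c ha.1, fun v w ↦ by simp [ha.2 v w]⟩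

end Tensors

section Kahler

variable {E : Type*} [NormedAddCommGroup E] [NormedSpace ℝ E] [FiniteDimensional ℝ E]
  {H : Type*} [TopologicalSpace H] {I : ModelWithCorners ℝ E H}
  {M : Type*} [TopologicalSpace M] [ChartedSpace H M] [IsManifold I ∞ M]
  [RiemannianBundle (fun x : M ↦ TangentSpace I x)]
  [IsContMDiffRiemannianBundle I ∞ E (fun x : M ↦ TangentSpace I x)]

/-- `(M, g, J)` is Kähler: `J` is a `g`-orthogonal almost complex structure which is parallel for
the Levi-Civita connection of `g`. -/
structure IsKahler (J : EndField I M) : Prop where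
  sq : ∀ (x : M) (v : TangentSpace I x), J x (J x v) = -v
  orthogonal : ∀ (x : M) (v w : TangentSpace I x), inner ℝ (J x v) (J x w) = inner ℝ v w
  parallel : nablaEnd (leviCivita I M) J = 0

/-- `h` is a section of `Sym^{2,-}TM`: it is `g`-symmetric and `hJ = -Jh`. -/
structure IsSymMinus (J h : EndField I M) : Prop where
  symm : ∀ (x : M) (v w : TangentSpace I x), inner ℝ (h x v) w = inner ℝ v (h x w)
  anti : ∀ (x : M) (v : TangentSpace I x), h x (J x v) = - J x (h x v)

/-- `∂h = ½ (d_∇ h + d_∇ h(J·, J·))`, with the Levi-Civita connection `∇`. -/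
def del (J h : EndField I M) : BilField I M := plusPart J (extD (leviCivita I M) h)

/-- `∂̄h = ½ (d_∇ h - d_∇ h(J·, J·))`, with the Levi-Civita connection `∇`. -/
def delbar (J h : EndField I M) : BilField I M := minusPart J (extD (leviCivita I M) h)

/-- `d⁺_∇ H = ½ (d_∇ H + d_∇ H(J·, J·))`, for `H` commuting with `J`. -/
def extDPlus (J H : EndField I M) : BilField I M := plusPart J (extD (leviCivita I M) H)

end Kahler

end KahlerFN

end

set_option linter.unusedSectionVars false

namespace KahlerFN

section Connection

variable {E : Type*} [NormedAddCommGroup E] [NormedSpace ℝ E] [FiniteDimensional ℝ E]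
  {H : Type*} [TopologicalSpace H] {I : ModelWithCorners ℝ E H}
  {M : Type*} [TopologicalSpace M] [ChartedSpace H M] [IsManifold I ∞ M]
  (cov : CovariantDerivative I E (TangentSpace I : M → Type _))

theorem nablaEnd_apply (h : EndField I M) {x : M} (v : TangentSpace I x)
    {Y : Π x : M, TangentSpace I x} (hY : MDiffAt (T% Y) x) :
    nablaEnd cov h x v (Y x) = cov (fun y ↦ h y (Y y)) x v - h x (cov Y x v) := by
  have h1 := TensorialAt.mkHom_apply (nablaEnd_tensorial cov h x) hY
  exact congrArg (fun A : TangentSpace I x →L[ℝ] TangentSpace I x ↦ A v) h1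

theorem cov_apply_endField (h : EndField I M) {x : M} (v : TangentSpace I x)
    {Y : Π x : M, TangentSpace I x} (hY : MDiffAt (T% Y) x) :
    cov (fun y ↦ h y (Y y)) x v = nablaEnd cov h x v (Y x) + h x (cov Y x v) := by
  rw [nablaEnd_apply cov h v hY, sub_add_cancel]

theorem nablaEnd_comp (h k : EndField I M) (x : M) (v w : TangentSpace I x) :
    nablaEnd cov (h.comp k) x v w = nablaEnd cov h x v (k x w) + h x (nablaEnd cov k x v w) := by
  have hw : MDiffAt (T% (extend E w : Π y : M, TangentSpace I y)) x :=
    mdifferentiableAt_extend ..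
  have h1 := nablaEnd_apply cov (h.comp k) v hw
  have h2 := cov_apply_endField cov h v (k.mdifferentiableAt_apply hw)
  have h3 := cov_apply_endField cov k v hw
  have h4 : (fun y ↦ (h.comp k) y ((extend E w : Π y : M, TangentSpace I y) y)) =
      fun y ↦ h y (k y ((extend E w : Π y : M, TangentSpace I y) y)) := rfl
  rw [h4, h2, h3] at h1
  simp only [extend_apply_self, map_add] at h1
  rw [h1]
  change _ + _ - h x (k x _) = _
  abel

theorem nablaEnd_of_anticommute {J h : EndField I M}
    (hanti : ∀ (x : M) (v : TangentSpace I x), h x (J x v) = - J x (h x v))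
    (hpar : nablaEnd cov J = 0) (x : M) (v w : TangentSpace I x) :
    nablaEnd cov h x v (J x w) = - J x (nablaEnd cov h x v w) := by
  have hw : MDiffAt (T% (extend E w : Π y : M, TangentSpace I y)) x :=
    mdifferentiableAt_extend ..
  have h0 (u u' : TangentSpace I x) : nablaEnd cov J x u u' = 0 := by rw [hpar]; rfl
  have h1 := nablaEnd_comp cov h J x v w
  have h2 := nablaEnd_comp cov J h x v w
  have h3 := nablaEnd_apply cov (h.comp J) v hw
  have h4 := nablaEnd_apply cov (J.comp h) v hw
  have h5 : (fun y ↦ (h.comp J) y ((extend E w : Π y : M, TangentSpace I y) y)) =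
      (-1 : ℝ) • fun y ↦ (J.comp h) y ((extend E w : Π y : M, TangentSpace I y) y) := by
    ext y
    change h y (J y _) = (-1 : ℝ) • J y (h y _)
    rw [hanti, neg_one_smul]
  have h6 : (h.comp J) x (cov (extend E w) x v) = - (J.comp h) x (cov (extend E w) x v) :=
    hanti _ _
  rw [h5, cov.isCovariantDerivativeOn.smul_const (-1) ((J.comp h).mdifferentiableAt_apply hw), h6] at h3
  simp only [extend_apply_self] at h3 h4
  rw [h0, map_zero, add_zero] at h1
  rw [h0, zero_add] at h2
  rw [← h1, ← h2, h3, h4]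
  simp
  abel

theorem fnBracket_apply_eq (htors : ∀ {X Y : Π x : M, TangentSpace I x} {x : M},
      MDiffAt (T% X) x → MDiffAt (T% Y) x →
        cov Y x (X x) - cov X x (Y x) = mlieBracket I X Y x)
    (h : EndField I M) (x : M) (v w : TangentSpace I x) :
    fnBracket h x v w = h x (nablaEnd cov h x v w - nablaEnd cov h x w v)
      - (nablaEnd cov h x (h x v) w - nablaEnd cov h x (h x w) v) := by
  have hv : MDiffAt (T% (extend E v : Π y : M, TangentSpace I y)) x :=
    mdifferentiableAt_extend ..
  have hw : MDiffAt (T% (extend E w : Π y : M, TangentSpace I y)) x :=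
    mdifferentiableAt_extend ..
  have hhv := h.mdifferentiableAt_apply hv
  have hhw := h.mdifferentiableAt_apply hw
  change fnAux h (extend E v) (extend E w) x = _
  rw [fnAux, ← htors hv hw, ← htors hhv hw, ← htors hv hhw, ← htors hhv hhw]
  simp only [cov_apply_endField cov h _ hv, cov_apply_endField cov h _ hw, extend_apply_self,
    map_add, map_sub]
  abel

end Connection

section Splitting

variable {E : Type*} [NormedAddCommGroup E] [NormedSpace ℝ E] [FiniteDimensional ℝ E]
  {H : Type*} [TopologicalSpace H] {I : ModelWithCorners ℝ E H}
  {M : Type*} [TopologicalSpace M] [ChartedSpace H M] [IsManifold I ∞ M]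
  {J : EndField I M}

theorem Lambda2.swap {x : M} {α : Bil I x} (hα : α ∈ Lambda2 I x) (v w : TangentSpace I x) :
    α w v = - α v w := by
  have h1 : α (v + w) (v + w) = 0 := hα _
  have h2 : α v v = 0 := hα _
  have h3 : α w w = 0 := hα _
  simp only [map_add, LinearMap.add_apply, h2, h3, zero_add, add_zero] at h1
  exact eq_neg_of_add_eq_zero_left h1

@[simp] theorem plusPart_apply (α : BilField I M) (x : M) (v w : TangentSpace I x) :
    plusPart J α x v w = (1 / 2 : ℝ) • (α x v w + α x (J x v) (J x w)) := rfl

@[simp] theorem minusPart_apply (α : BilField I M) (x : M) (v w : TangentSpace I x) :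
    minusPart J α x v w = (1 / 2 : ℝ) • (α x v w - α x (J x v) (J x w)) := rfl

@[simp] theorem lambdaMinusPart_apply (γ : BilField I M) (x : M) (v w : TangentSpace I x) :
    lambdaMinusPart J γ x v w = (1 / 2 : ℝ) • (γ x v w + J x (γ x v (J x w))) := rfl

@[simp] theorem sharp_apply (h : EndField I M) (α : BilField I M) (x : M)
    (v w : TangentSpace I x) : sharp h α x v w = α x (h x v) w + α x v (h x w) := rfl

@[simp] theorem postComp_apply (h : EndField I M) (α : BilField I M) (x : M)
    (v w : TangentSpace I x) : postComp h α x v w = h x (α x v w) := rfl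

@[simp] theorem extD_apply (cov : CovariantDerivative I E (TangentSpace I : M → Type _))
    (h : EndField I M) (x : M) (v w : TangentSpace I x) :
    extD cov h x v w = nablaEnd cov h x v w - nablaEnd cov h x w v := rfl

@[simp] theorem EndField.comp_apply (h k : EndField I M) (x : M) (v : TangentSpace I x) :
    h.comp k x v = h x (k x v) := rfl

theorem extD_mem_Lambda2 (cov : CovariantDerivative I E (TangentSpace I : M → Type _))
    (h : EndField I M) (x : M) : extD cov h x ∈ Lambda2 I x := fun v ↦ by simp

theorem plusPart_mem_Lambda11 (hsq : ∀ (x : M) (v : TangentSpace I x), J x (J x v) = -v)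
    {α : BilField I M} {x : M} (hα : α x ∈ Lambda2 I x) : plusPart J α x ∈ Lambda11 J x := by
  refine ⟨fun v ↦ ?_, fun v w ↦ ?_⟩
  · have h1 : α x v v = 0 := hα _
    have h2 : α x (J x v) (J x v) = 0 := hα _
    simp [h1, h2]
  · simp [hsq, add_comm]

theorem minusPart_mem_lambda2 (hsq : ∀ (x : M) (v : TangentSpace I x), J x (J x v) = -v)
    {α : BilField I M} {x : M} (hα : α x ∈ Lambda2 I x) : minusPart J α x ∈ lambda2 J x := by
  refine ⟨fun v ↦ ?_, fun v w ↦ ?_⟩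
  · have h1 : α x v v = 0 := hα _
    have h2 : α x (J x v) (J x v) = 0 := hα _
    simp [h1, h2]
  · simp only [minusPart_apply, hsq, map_neg, LinearMap.neg_apply]
    module

theorem lambda2.apply_J_left (hsq : ∀ (x : M) (v : TangentSpace I x), J x (J x v) = -v)
    {x : M} {γ : Bil I x} (hγ : γ ∈ lambda2 J x) (v w : TangentSpace I x) :
    γ (J x v) w = γ v (J x w) := by
  have h1 := hγ.2 v (J x w)
  simpa [hsq] using h1

theorem lambdaMinusPart_mem_lambda2Minus
    (hsq : ∀ (x : M) (v : TangentSpace I x), J x (J x v) = -v)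
    {γ : BilField I M} {x : M} (hγ : γ x ∈ lambda2 J x) :
    lambdaMinusPart J γ x ∈ lambda2Minus J x := by
  refine ⟨⟨fun v ↦ ?_, fun v w ↦ ?_⟩, fun v w ↦ ?_⟩
  · have h1 : γ x v v = 0 := hγ.1 _
    have h2 : γ x v (J x v) = 0 := by
      have h3 := Lambda2.swap hγ.1 v (J x v)
      rw [lambda2.apply_J_left hsq hγ] at h3
      have h4 : (2 : ℝ) • γ x v (J x v) = 0 := by
        rw [two_smul]
        exact eq_neg_iff_add_eq_zero.1 h3
      simpa using h4
    simp [h1, h2]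
  · simp only [lambdaMinusPart_apply, hsq, map_neg, lambda2.apply_J_left hsq hγ]
    module
  · simp only [lambdaMinusPart_apply, hsq, map_neg, map_add, map_smul]
    module

theorem sub_lambdaMinusPart_mem_lambda2Plus
    (hsq : ∀ (x : M) (v : TangentSpace I x), J x (J x v) = -v)
    {γ : BilField I M} {x : M} (hγ : γ x ∈ lambda2 J x) :
    γ x - lambdaMinusPart J γ x ∈ lambda2Plus J x := by
  refine ⟨sub_mem hγ (lambdaMinusPart_mem_lambda2Minus hsq hγ).1, fun v w ↦ ?_⟩
  simp only [LinearMap.sub_apply, lambdaMinusPart_apply, hsq, map_neg, map_add, map_smul, map_sub]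
  module

theorem lambda2Minus_sup_lambda2Plus_sup_Lambda11
    (hsq : ∀ (x : M) (v : TangentSpace I x), J x (J x v) = -v) (x : M) :
    lambda2Minus J x ⊔ lambda2Plus J x ⊔ Lambda11 J x = Lambda2 I x := by
  classical
  apply le_antisymm
  · exact sup_le (sup_le (fun _ h ↦ h.1.1) fun _ h ↦ h.1.1) fun _ h ↦ h.1
  · intro α hα
    let β : BilField I M := Function.update 0 x α
    have hβ : β x = α := Function.update_self ..
    have hβ2 : β x ∈ Lambda2 I x := hβ.symm ▸ hα
    have h1 := minusPart_mem_lambda2 hsq hβ2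
    have h2 := lambdaMinusPart_mem_lambda2Minus hsq h1
    have h3 := sub_lambdaMinusPart_mem_lambda2Plus hsq h1
    have h4 := plusPart_mem_Lambda11 hsq hβ2
    have h5 : α = lambdaMinusPart J (minusPart J β) x
        + (minusPart J β x - lambdaMinusPart J (minusPart J β) x) + plusPart J β x := by
      rw [add_sub_cancel, ← hβ]
      ext v w
      simp only [LinearMap.add_apply, minusPart_apply, plusPart_apply]
      module
    rw [h5]
    exact Submodule.add_mem_sup (Submodule.add_mem_sup h2 h3) h4

theorem iSupIndep_lambda2Minus_lambda2Plus_Lambda11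
    (hsq : ∀ (x : M) (v : TangentSpace I x), J x (J x v) = -v) (x : M) :
    iSupIndep ![lambda2Minus J x, lambda2Plus J x, Lambda11 J x] := by
  have key : ∀ a ∈ lambda2Minus J x, ∀ b ∈ lambda2Plus J x, ∀ c ∈ Lambda11 J x,
      a + b + c = 0 → a = 0 ∧ b = 0 ∧ c = 0 := by
    intro a ha b hb c hc habc
    have e (v w : TangentSpace I x) : a v w + b v w + c v w = 0 :=
      congrArg (fun f : Bil I x ↦ f v w) habc
    have hc0 : c = 0 := by
      ext v w
      have h1 := e v w
      have h2 := e (J x v) (J x w)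
      rw [ha.1.2, hb.1.2, hc.2] at h2
      have h3 : (2 : ℝ) • c v w = 0 := by
        linear_combination (norm := module) h1 + h2
      simpa using h3
    have hb0 : b = 0 := by
      ext v w
      have h1 := congrArg (J x) (e v w)
      have h2 := e v (J x w)
      rw [ha.2, hb.2] at h2
      simp only [hc0, LinearMap.zero_apply, add_zero, map_add, map_zero] at h1 h2
      have h3 : (2 : ℝ) • J x (b v w) = 0 := by
        linear_combination (norm := module) h1 + h2
      have h4 : J x (b v w) = 0 := by simpa using h3
      have h5 := hsq x (b v w)
      rw [h4, map_zero] at h5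
      simpa using h5.symm
    refine ⟨?_, hb0, hc0⟩
    simpa [hb0, hc0] using habc
  rw [iSupIndep_fin_three]
  simp only [Matrix.cons_val_zero, Matrix.cons_val_one, Matrix.cons_val]
  refine ⟨?_, ?_, ?_⟩
  all_goals
    rw [Submodule.disjoint_def]
    intro a ha hbc
    obtain ⟨b, hb, c, hc, hbc⟩ := Submodule.mem_sup.1 hbc
  · exact (key a ha (-b) (neg_mem hb) (-c) (neg_mem hc) (by rw [← hbc]; abel)).1
  · exact (key (-c) (neg_mem hc) a ha (-b) (neg_mem hb) (by rw [← hbc]; abel)).2.1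
  · exact (key (-b) (neg_mem hb) (-c) (neg_mem hc) a ha (by rw [← hbc]; abel)).2.2

end Splitting

section Kahler

variable {E : Type*} [NormedAddCommGroup E] [NormedSpace ℝ E] [FiniteDimensional ℝ E]
  {H : Type*} [TopologicalSpace H] {I : ModelWithCorners ℝ E H}
  {M : Type*} [TopologicalSpace M] [ChartedSpace H M] [IsManifold I ∞ M]
  [RiemannianBundle (fun x : M ↦ TangentSpace I x)]
  [IsContMDiffRiemannianBundle I ∞ E (fun x : M ↦ TangentSpace I x)]
  {J h : EndField I M}

/-- The Frölicher–Nijenhuis bracket in terms of the Levi-Civita connection: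
`[h,h](X,Y) = h(d_∇ h(X,Y)) - ((∇_{hX} h)Y - (∇_{hY} h)X)`. -/
theorem fnBracket_apply_leviCivita (h : EndField I M) (x : M) (v w : TangentSpace I x) :
    fnBracket h x v w =
      h x (nablaEnd (leviCivita I M) h x v w - nablaEnd (leviCivita I M) h x w v)
      - (nablaEnd (leviCivita I M) h x (h x v) w - nablaEnd (leviCivita I M) h x (h x w) v) := by
  have : CompleteSpace E := FiniteDimensional.complete ℝ E
  exact fnBracket_apply_eq _
    (fun hX hY ↦ (leviCivita I M).torsion_eq_zero_iff.1 leviCivita_torsion hX hY) h x v w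

theorem fnBracket_mem_Lambda2 (h : EndField I M) (x : M) : fnBracket h x ∈ Lambda2 I x :=
  fun v ↦ by simp [fnBracket_apply_leviCivita]

theorem IsKahler.nablaEnd_J_comp (hJ : IsKahler J) (h : EndField I M) (x : M)
    (v w : TangentSpace I x) :
    nablaEnd (leviCivita I M) (J.comp h) x v w = J x (nablaEnd (leviCivita I M) h x v w) := by
  rw [nablaEnd_comp, hJ.parallel]
  exact zero_add _

theorem IsSymMinus.nablaEnd_apply_J (hJ : IsKahler J) (hh : IsSymMinus J h) (x : M)
    (v w : TangentSpace I x) :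
    nablaEnd (leviCivita I M) h x v (J x w) = - J x (nablaEnd (leviCivita I M) h x v w) :=
  nablaEnd_of_anticommute _ hh.anti hJ.parallel x v w

/-- `[h,h]^c(X,Y) = -½ ((∇_{hX} h)Y - (∇_{hY} h)X - J(∇_{JhX} h)Y + J(∇_{JhY} h)X)`. -/
theorem ksBracket_apply (hJ : IsKahler J) (hh : IsSymMinus J h) (x : M)
    (v w : TangentSpace I x) :
    ksBracket J h x v w = -((1 / 2 : ℝ) •
      (nablaEnd (leviCivita I M) h x (h x v) w - nablaEnd (leviCivita I M) h x (h x w) v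
        - J x (nablaEnd (leviCivita I M) h x (J x (h x v)) w)
        + J x (nablaEnd (leviCivita I M) h x (J x (h x w)) v))) := by
  simp only [ksBracket, lambdaMinusPart_apply, minusPart_apply, fnBracket_apply_leviCivita,
    hh.nablaEnd_apply_J hJ, hh.anti, hJ.sq, map_neg, map_sub, map_smul,
    LinearMap.neg_apply]
  module

theorem delbar_mem_lambda2Minus (hJ : IsKahler J) (hh : IsSymMinus J h) (x : M) :
    delbar J h x ∈ lambda2Minus J x := by
  refine ⟨minusPart_mem_lambda2 hJ.sq (extD_mem_Lambda2 _ h x), fun v w ↦ ?_⟩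
  simp only [delbar, minusPart_apply, extD_apply, hh.nablaEnd_apply_J hJ, hJ.sq, map_neg, map_sub,
    map_smul]
  module

theorem postComp_mem_lambda2Plus (hh : IsSymMinus J h) {α : BilField I M} {x : M}
    (hα : α x ∈ lambda2Minus J x) : postComp h α x ∈ lambda2Plus J x := by
  refine ⟨⟨fun v ↦ ?_, fun v w ↦ ?_⟩, fun v w ↦ ?_⟩
  · rw [postComp_apply, show α x v v = 0 from hα.1.1 v, map_zero]
  · rw [postComp_apply, hα.1.2, map_neg, postComp_apply]
  · rw [postComp_apply, hα.2, map_neg, hh.anti, neg_neg, postComp_apply]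

theorem sharp_mem_Lambda11 (hh : IsSymMinus J h) {α : BilField I M} {x : M}
    (hα : α x ∈ lambda2 J x) : sharp h α x ∈ Lambda11 J x := by
  refine ⟨fun v ↦ ?_, fun v w ↦ ?_⟩
  · rw [sharp_apply, Lambda2.swap hα.1 v (h x v), neg_add_cancel]
  · simp [hh.anti, hα.2]

theorem fnBracket_eq_typeDecomposition (hJ : IsKahler J) (hh : IsSymMinus J h) :
    fnBracket h = ksBracket J h + postComp h (delbar J h)
      + (extDPlus J (h.comp h) - sharp h (delbar J h)) := by
  funext x
  ext v w
  change _ = ksBracket J h x v w + postComp h (delbar J h) x v w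
    + (extDPlus J (h.comp h) x v w - sharp h (delbar J h) x v w)
  simp only [ksBracket_apply hJ hh, postComp_apply, delbar, extDPlus, sharp_apply, minusPart_apply,
    plusPart_apply, extD_apply, fnBracket_apply_leviCivita, nablaEnd_comp,
    hh.nablaEnd_apply_J hJ, hh.anti, map_neg, map_sub, map_smul]
  module

theorem ksBracket_eq_sharp_del (hJ : IsKahler J) (hh : IsSymMinus J h) :
    ksBracket J h = -((1 / 2 : ℝ) • (sharp h (del J h)
      - sharp (J.comp h) (del J (J.comp h)))) := by
  funext x
  ext v w
  change _ = -((1 / 2 : ℝ) • (sharp h (del J h) x v w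
    - sharp (J.comp h) (del J (J.comp h)) x v w))
  simp only [ksBracket_apply hJ hh, del, sharp_apply, EndField.comp_apply,
    plusPart_apply, extD_apply, hJ.nablaEnd_J_comp,
    hh.nablaEnd_apply_J hJ, hJ.sq, map_neg, LinearMap.neg_apply]
  module

theorem ksBracket_eq_sub_fnBracket (hJ : IsKahler J) (hh : IsSymMinus J h) :
    ksBracket J h = (1 / 2 : ℝ) • (fnBracket h - fnBracket (J.comp h)) := by
  funext x
  ext v w
  change _ = (1 / 2 : ℝ) • (fnBracket h x v w - fnBracket (J.comp h) x v w)
  simp only [ksBracket_apply hJ hh, fnBracket_apply_leviCivita, EndField.comp_apply,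
    hJ.nablaEnd_J_comp, hh.anti, hJ.sq, map_neg, map_sub]
  module

end Kahler

end KahlerFN

theorem mainTheorem5
    {E : Type*} [NormedAddCommGroup E] [NormedSpace ℝ E] [FiniteDimensional ℝ E]
    {H : Type*} [TopologicalSpace H] {I : ModelWithCorners ℝ E H}
    {M : Type*} [TopologicalSpace M] [ChartedSpace H M] [IsManifold I ∞ M]
    [BoundarylessManifold I M]
    [RiemannianBundle (fun x : M ↦ TangentSpace I x)]
    [IsContMDiffRiemannianBundle I ∞ E (fun x : M ↦ TangentSpace I x)]
    (J : KahlerFN.EndField I M) (hJ : KahlerFN.IsKahler J)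
    (h : KahlerFN.EndField I M) (hh : KahlerFN.IsSymMinus J h) :
    -- the splitting `Λ²(M,TM) = λ²₋(M,TM) ⊕ λ²₊(M,TM) ⊕ Λ^{1,1}(M,TM)`
    (∀ x : M,
      iSupIndep ![KahlerFN.lambda2Minus J x, KahlerFN.lambda2Plus J x, KahlerFN.Lambda11 J x] ∧
      KahlerFN.lambda2Minus J x ⊔ KahlerFN.lambda2Plus J x ⊔ KahlerFN.Lambda11 J x
        = KahlerFN.Lambda2 I x) ∧
    -- the type decomposition of the Frölicher–Nijenhuis bracket
    (KahlerFN.fnBracket h =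
      KahlerFN.ksBracket J h + KahlerFN.postComp h (KahlerFN.delbar J h)
        + (KahlerFN.extDPlus J (h.comp h) - KahlerFN.sharp h (KahlerFN.delbar J h))) ∧
    (∀ x : M, KahlerFN.ksBracket J h x ∈ KahlerFN.lambda2Minus J x) ∧
    (∀ x : M, KahlerFN.postComp h (KahlerFN.delbar J h) x ∈ KahlerFN.lambda2Plus J x) ∧
    (∀ x : M, (KahlerFN.extDPlus J (h.comp h) - KahlerFN.sharp h (KahlerFN.delbar J h)) x
      ∈ KahlerFN.Lambda11 J x) ∧
    -- the two expressions of the Kodaira–Spencer bracket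
    KahlerFN.ksBracket J h =
      -((1 / 2 : ℝ) • (KahlerFN.sharp h (KahlerFN.del J h)
        - KahlerFN.sharp (J.comp h) (KahlerFN.del J (J.comp h)))) ∧
    KahlerFN.ksBracket J h =
      (1 / 2 : ℝ) • (KahlerFN.fnBracket h - KahlerFN.fnBracket (J.comp h)) := by
  refine ⟨fun x ↦ ⟨KahlerFN.iSupIndep_lambda2Minus_lambda2Plus_Lambda11 hJ.sq x,
      KahlerFN.lambda2Minus_sup_lambda2Plus_sup_Lambda11 hJ.sq x⟩,
    KahlerFN.fnBracket_eq_typeDecomposition hJ hh, fun x ↦ ?_, fun x ↦ ?_, fun x ↦ ?_,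
    KahlerFN.ksBracket_eq_sharp_del hJ hh, KahlerFN.ksBracket_eq_sub_fnBracket hJ hh⟩
  · exact KahlerFN.lambdaMinusPart_mem_lambda2Minus hJ.sq
      (KahlerFN.minusPart_mem_lambda2 hJ.sq (KahlerFN.fnBracket_mem_Lambda2 h x))
  · exact KahlerFN.postComp_mem_lambda2Plus hh (KahlerFN.delbar_mem_lambda2Minus hJ hh x)
  · exact sub_mem (KahlerFN.plusPart_mem_Lambda11 hJ.sq (KahlerFN.extD_mem_Lambda2 _ _ x))
      (KahlerFN.sharp_mem_Lambda11 hh (KahlerFN.delbar_mem_lambda2Minus hJ hh x).1)
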